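/- Let $\mathbb T=\mathbb R/2\pi\mathbb Z$ and let $f,g:\mathbb T\to\mathbb R$ be continuous with $g\ge 0$. Let $\Pi$ and $\Pi_n$ ($n\ge 0$) be the orthogonal projections of $L^2(\mathbb T)$ (complex valued) onto the closed subspaces of functions whose Fourier coefficients $\widehat u_k=\frac1{2\pi}\int_{-\pi}^{\pi}u(x)e^{-ikx}\,dx$ vanish for all $k\notin\{0,1,2,\dots\}$, respectively for all $k\notin\{0,\dots,n\}$. For $h\in L^\infty(\mathbb T)$ let $T(h)=\Pi h\Pi$, as an operator on $\operatorname{Im}\Pi$, and $T_n(h)=\Pi_n h\Pi_n$, as an operator on $\operatorname{Im}\Pi_n$, be the Toeplitz operator and its finite section (in the basis $e^{ikx}$ their matrices are $(\widehat h_{i-j})_{i,j\ge 0}$ and $(\widehat h_{i-j})_{0\le i,j\le n}$). Then the spectra $\sigma(T_n(f)T_n(g))$, $n\ge 0$, and $\sigma(T(f)T(g))$ are contained in $\mathbb R$ and have a maximum and a minimum, and, as $n\to\infty$, $$\max\sigma\big(T_n(f)T_n(g)\big)\longrightarrow\max\sigma\big(T(f)T(g)\big)\quad\text{and}\quad \min\sigma\big(T_n(f)T_n(g)\big)\longrightarrow\min\sigma\big(T(f)T(g)\big).$$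 -/

import Mathlib

open Filter Topology MeasureTheory
open scoped ENNReal

noncomputable section

namespace ToeplitzProduct

/-- The torus `ℝ / 2πℤ`. -/
abbrev Torus : Type := AddCircle (2 * Real.pi)

instance instFactTwoPiPos : Fact (0 < 2 * Real.pi) := ⟨Real.two_pi_pos⟩

/-- `L²(𝕋)`, complex valued, for the normalized Lebesgue measure `dx / 2π`. -/
abbrev L2 : Type := Lp ℂ 2 (AddCircle.haarAddCircle : Measure Torus)

/-- `L^∞(𝕋)`, complex valued. -/
abbrev LInf : Type := Lp ℂ ∞ (AddCircle.haarAddCircle : Measure Torus)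

/-- The closed subspace of all `u ∈ L²(𝕋)` whose Fourier coefficients
`(1 / 2π) ∫ u(x) e^{-ikx} dx` vanish for all frequencies `k ∉ S`. -/
def freqSpace (S : Set ℤ) : Submodule ℂ L2 where
  carrier := {u | ∀ k ∉ S, fourierCoeff (u : Torus → ℂ) k = 0}
  zero_mem' := by
    intro k _
    rw [← fourierBasis_repr]
    simp
  add_mem' := by
    intro u v hu hv k hk
    have h1 := hu k hk
    have h2 := hv k hk
    rw [← fourierBasis_repr] at h1 h2 ⊢
    simp [h1, h2]
  smul_mem' := by
    intro c u hu k hk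
    have h1 := hu k hk
    rw [← fourierBasis_repr] at h1 ⊢
    simp [h1]

theorem isClosed_freqSpace (S : Set ℤ) : IsClosed (freqSpace S : Set L2) := by
  have h : (freqSpace S : Set L2) =
      ⋂ k ∈ Sᶜ, {u : L2 | inner ℂ (fourierBasis (T := 2 * Real.pi) k) u = 0} := by
    ext u
    simp only [freqSpace, Submodule.coe_set_mk, AddSubmonoid.coe_set_mk,
      AddSubsemigroup.coe_set_mk, Set.mem_ofPred_eq, Set.mem_iInter, Set.mem_compl_iff,
      ← fourierBasis_repr, HilbertBasis.repr_apply_apply]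
  rw [h]
  exact isClosed_biInter fun k _ =>
    isClosed_eq (continuous_const.inner continuous_id) continuous_const

instance instCompleteSpaceFreqSpace (S : Set ℤ) : CompleteSpace (freqSpace S) :=
  (isClosed_freqSpace S).completeSpace_coe

/-- The range of `Π`: nonnegative frequencies. -/
abbrev imPi : Submodule ℂ L2 := freqSpace (Set.Ici 0)

/-- The range of `Π_n`: frequencies `0, …, n`. -/
abbrev imPiN (n : ℕ) : Submodule ℂ L2 := freqSpace (Set.Icc 0 (n : ℤ))

/-- Multiplication by `f ∈ L^∞(𝕋)` as a bounded operator on `L²(𝕋)`. -/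
def mulOp (f : LInf) : L2 →L[ℂ] L2 :=
  (ContinuousLinearMap.mul ℂ ℂ).holderL AddCircle.haarAddCircle ∞ 2 2 f

/-- The operator `P f P` on the range of `P`, where `P` is the orthogonal projection onto a
subspace `K` of `L²(𝕋)`. -/
def cutOff (K : Submodule ℂ L2) [K.HasOrthogonalProjection] (f : LInf) : K →L[ℂ] K :=
  K.orthogonalProjectionOnto ∘L mulOp f ∘L K.subtypeL

/-- The Toeplitz operator `T(f) = Π f Π` on the range of `Π`. -/
def toeplitz (f : LInf) : imPi →L[ℂ] imPi := cutOff imPi f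

/-- The finite section `T_n(f) = Π_n f Π_n` on the range of `Π_n`. -/
def toeplitzN (n : ℕ) (f : LInf) : imPiN n →L[ℂ] imPiN n := cutOff (imPiN n) f

/-- A real continuous function on the torus as an element of `L^∞(𝕋)`. -/
def symbol (f : C(Torus, ℝ)) : LInf :=
  ContinuousMap.toLp ∞ AddCircle.haarAddCircle ℂ
    ((⟨Complex.ofReal, Complex.continuous_ofReal⟩ : C(ℝ, ℂ)).comp f)

/-- The set of real points of the (complex) spectrum `σ(A)`. -/
def realSpectrum {A : Type*} [Ring A] [Algebra ℂ A] (a : A) : Set ℝ :=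
  {x : ℝ | (x : ℂ) ∈ spectrum ℂ a}

/-- `λ_max(f, g)`, the maximum of `σ(T(f) T(g))`. -/
def lambdaMax (f g : C(Torus, ℝ)) : ℝ :=
  sSup (realSpectrum (toeplitz (symbol f) * toeplitz (symbol g)))

/-- `λ_min(f, g)`, the minimum of `σ(T(f) T(g))`. -/
def lambdaMin (f g : C(Torus, ℝ)) : ℝ :=
  sInf (realSpectrum (toeplitz (symbol f) * toeplitz (symbol g)))

/-- `λ_max^n(f, g)`, the maximum of `σ(T_n(f) T_n(g))`. -/
def lambdaMaxN (n : ℕ) (f g : C(Torus, ℝ)) : ℝ :=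
  sSup (realSpectrum (toeplitzN n (symbol f) * toeplitzN n (symbol g)))

/-- `λ_min^n(f, g)`, the minimum of `σ(T_n(f) T_n(g))`. -/
def lambdaMinN (n : ℕ) (f g : C(Torus, ℝ)) : ℝ :=
  sInf (realSpectrum (toeplitzN n (symbol f) * toeplitzN n (symbol g)))

end ToeplitzProduct

end

/-!
Write `A = T(f)`, `B = T(g)`, with finite sections `A_n`, `B_n`. As `B ≥ 0`, the spectrum of `A B`
equals that of the self-adjoint operator `√B A √B` (`spectrum_mul_eq_sqrt`), so it is real, compact
and nonempty; the same holds for `A_n B_n`. Replacing `f` by `-f` turns minima into maxima, so only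
the maxima are treated.

*Lower bound.* The condition `√B A √B ≤ M` is equivalent to inequalities between the quadratic forms
of `B A B`, `B` and the identity (`realSpectrum_mul_le_iff`). Since `A_n → A` and `B_n → B` strongly,
these inequalities pass to the limit, so `λ_max ≤ M` whenever `λ_max^n ≤ M` for infinitely many `n`.

*Upper bound.* Let `t_n → s` be eigenvalues of `A_n B_n` with unit eigenvectors `u_n`, and suppose
that `s` is not in the spectrum of `A B`. Then `s - B A` is onto, and pairing its values with `u_n`
shows that `u_n → 0` weakly (`tendsto_inner_eigenvector`). The antiunitary map
`u ↦ e^{inx} * conj u` reverses the frequencies `0, …, n` and commutes with `A_n` and `B_n`, because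
the symbols are real; hence the last coefficients of `u_n` tend to zero as well as the first ones.
For a trigonometric polynomial, and so for the continuous function `g`, multiplication moves such
`u_n` out of the range of `Π_n` only by an error tending to zero
(`tendsto_mulC_sub_starProjection`). Therefore `t_n = ⟨f u_n, Π_n (g u_n)⟩` is within `o(1)` of
`∫ f g |u_n|² ≤ max (f g)`, and `s ≤ max (f g)`. Finally every value of `f g` is in the spectrum of
`A B` (`mul_apply_mem_realSpectrum`), by approximate eigenvectors concentrated at a point, so that
`s ≤ λ_max` in every case.
-/

noncomputable section

namespace ToeplitzProduct

/-! ### Products of a self-adjoint and a nonnegative operator -/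

theorem realSpectrum_eq {A : Type*} [Ring A] [Algebra ℂ A] [Algebra ℝ A] [IsScalarTower ℝ ℂ A]
    (a : A) : realSpectrum a = spectrum ℝ a := by
  ext x
  exact spectrum.algebraMap_mem_iff ℂ (r := x) (a := a)

/-- The spectra of `a * b` and of the self-adjoint element `√b * a * √b` agree, including at `0`:
if either product is invertible then so is `b`, and then the two are similar. -/
theorem spectrum_mul_eq_sqrt {E : Type*} [CStarAlgebra E] [PartialOrder E] [StarOrderedRing E]
    (a : E) {b : E} (hb : 0 ≤ b) :
    spectrum ℂ (a * b) = spectrum ℂ (CFC.sqrt b * a * CFC.sqrt b) := by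
  have hRR : CFC.sqrt b * CFC.sqrt b = b := CFC.sqrt_mul_sqrt_self b hb
  set r := CFC.sqrt b
  by_cases hu : IsUnit b
  · have hr : IsUnit r := by
      refine isUnit_iff_exists_and_exists.2 ⟨⟨r * hu.unit⁻¹, ?_⟩, ⟨hu.unit⁻¹ * r, ?_⟩⟩
      · rw [← mul_assoc, hRR, hu.mul_val_inv]
      · rw [mul_assoc, hRR, hu.val_inv_mul]
    obtain ⟨u, hur⟩ := hr
    have : r * a * r = u * (a * b) * (↑u⁻¹ : E) := by
      rw [← hRR, ← hur]; simp only [mul_assoc, Units.mul_inv, mul_one]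
    rw [this, spectrum.units_conjugate]
  · have h1 : (0 : ℂ) ∈ spectrum ℂ (a * b) := by
      rw [spectrum.zero_mem_iff]
      intro h
      have hl : (↑h.unit⁻¹ * a) * b = 1 := by rw [mul_assoc, h.val_inv_mul]
      refine hu (isUnit_iff_exists_and_exists.2 ⟨⟨star (↑h.unit⁻¹ * a), ?_⟩, ⟨_, hl⟩⟩)
      have := congrArg star hl
      rwa [star_mul, star_one, (IsSelfAdjoint.of_nonneg hb).star_eq] at this
    have h2 : (0 : ℂ) ∈ spectrum ℂ (r * a * r) := by
      rw [spectrum.zero_mem_iff]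
      intro h
      have hr : IsUnit r := isUnit_iff_exists_and_exists.2
        ⟨⟨a * r * ↑h.unit⁻¹, by rw [← mul_assoc, ← mul_assoc, h.mul_val_inv]⟩,
          ⟨↑h.unit⁻¹ * (r * a), by rw [mul_assoc, h.val_inv_mul]⟩⟩
      exact hu (hRR ▸ hr.mul hr)
    have h3 := spectrum.nonzero_mul_comm (𝕜 := ℂ) (a * r) r
    rw [mul_assoc a r r, hRR, ← mul_assoc r a r] at h3
    rw [← Set.insert_sdiff_self_of_mem h1, h3, Set.insert_sdiff_self_of_mem h2]

theorem isSelfAdjoint_sqrt_mul_mul_sqrt {E : Type*} [CStarAlgebra E] [PartialOrder E]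
    [StarOrderedRing E] {a b : E} (ha : IsSelfAdjoint a) :
    IsSelfAdjoint (CFC.sqrt b * a * CFC.sqrt b) := by
  have hr : IsSelfAdjoint (CFC.sqrt b) := .of_nonneg (CFC.sqrt_nonneg b)
  have := ha.conjugate (CFC.sqrt b)
  rwa [hr.star_eq] at this

theorem realSpectrum_mul_eq_sqrt {E : Type*} [CStarAlgebra E] [PartialOrder E]
    [StarOrderedRing E] (a : E) {b : E} (hb : 0 ≤ b) :
    realSpectrum (a * b) = spectrum ℝ (CFC.sqrt b * a * CFC.sqrt b) := by
  rw [← realSpectrum_eq, realSpectrum, spectrum_mul_eq_sqrt a hb]; rfl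

theorem isCompact_realSpectrum {E : Type*} [CStarAlgebra E] (a : E) :
    IsCompact (realSpectrum a) := by
  rw [realSpectrum_eq]; exact spectrum.isCompact a

theorem realSpectrum_mul_nonempty {E : Type*} [CStarAlgebra E] [PartialOrder E]
    [StarOrderedRing E] [Nontrivial E] {a b : E} (ha : IsSelfAdjoint a) (hb : 0 ≤ b) :
    (realSpectrum (a * b)).Nonempty := by
  rw [realSpectrum_mul_eq_sqrt a hb]
  exact ContinuousFunctionalCalculus.spectrum_nonempty _ (isSelfAdjoint_sqrt_mul_mul_sqrt ha)

theorem realSpectrum_neg_mul {H : Type*} [NormedAddCommGroup H] [NormedSpace ℂ H]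
    (A B : H →L[ℂ] H) : realSpectrum (-A * B) = -realSpectrum (A * B) := by
  rw [realSpectrum_eq, realSpectrum_eq, neg_mul, spectrum.neg_eq]

section Hilbert

variable {H : Type*} [NormedAddCommGroup H] [InnerProductSpace ℂ H] [CompleteSpace H]

open ContinuousLinearMap

theorem isUnit_sub_mul_of_notMem_realSpectrum {A B : H →L[ℂ] H} (hA : IsSelfAdjoint A)
    (hB : IsSelfAdjoint B) {s : ℝ} (hs : s ∉ realSpectrum (A * B)) :
    IsUnit (algebraMap ℂ (H →L[ℂ] H) s - B * A) := by
  have hs' : (s : ℂ) ∉ spectrum ℂ (A * B) := hs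
  have h := (spectrum.notMem_iff.1 hs').star
  rwa [star_sub, star_mul, hA.star_eq, hB.star_eq, ← algebraMap_star_comm, RCLike.star_def,
    Complex.conj_ofReal] at h

theorem inner_sqrt_apply_sqrt_apply {B : H →L[ℂ] H} (hB : 0 ≤ B) (x y : H) :
    inner ℂ (CFC.sqrt B x) (CFC.sqrt B y) = inner ℂ (B x) y := by
  have hr : IsSelfAdjoint (CFC.sqrt B) := .of_nonneg (CFC.sqrt_nonneg B)
  have h := hr.isSymmetric (CFC.sqrt B x) y
  refine h.symm.trans ?_
  change inner ℂ ((CFC.sqrt B * CFC.sqrt B) x) y = _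
  rw [CFC.sqrt_mul_sqrt_self B hB]

theorem spectrum_le_iff_re_inner_le {S : H →L[ℂ] H} (hS : IsSelfAdjoint S) (M : ℝ) :
    (∀ t ∈ spectrum ℝ S, t ≤ M) ↔ ∀ y, (inner ℂ (S y) y).re ≤ M * ‖y‖ ^ 2 := by
  rw [← le_algebraMap_iff_spectrum_le (a := S), ContinuousLinearMap.le_def, isPositive_def]
  have hM : IsSelfAdjoint (algebraMap ℝ (H →L[ℂ] H) M) := by
    rw [IsSelfAdjoint, ← algebraMap_star_comm]; simp
  have key (y : H) : (algebraMap ℝ (H →L[ℂ] H) M - S).reApplyInnerSelf y =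
      M * ‖y‖ ^ 2 - (inner ℂ (S y) y).re := by
    rw [reApplyInnerSelf_apply, sub_apply, inner_sub_left, Algebra.algebraMap_eq_smul_one]
    simp only [smul_apply, one_apply_eq_self, map_sub]
    congr 1
    rw [← Complex.coe_smul, inner_smul_left, inner_self_eq_norm_sq_to_K]
    simp [← Complex.ofReal_pow]
  simp only [key, sub_nonneg]
  exact ⟨fun h => h.2, fun h => ⟨(hM.sub hS).isSymmetric, h⟩⟩

/-- The spectrum of `A * B`, for `A` self-adjoint and `B` nonnegative, lies below `M` if and only
if two inequalities between quadratic forms hold that do not involve the square root of `B`, and so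
pass to strong limits. The first says that `√B A √B ≤ M` on the range of `√B`. The second is used
only at `B x = 0`, where it says that `0 ≤ M` as soon as `B` has a nonzero kernel. -/
theorem realSpectrum_mul_le_iff {A B : H →L[ℂ] H} (hA : IsSelfAdjoint A) (hB : 0 ≤ B) {C : ℝ}
    (hC : ‖A‖ ≤ C) (M : ℝ) :
    (∀ t ∈ realSpectrum (A * B), t ≤ M) ↔
      (∀ x, (inner ℂ (A (B x)) (B x)).re ≤ M * (inner ℂ (B x) x).re) ∧
        ∀ x, -(C * (inner ℂ (B x) x).re) ≤ M * ‖x‖ ^ 2 := by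
  rw [realSpectrum_mul_eq_sqrt A hB,
    spectrum_le_iff_re_inner_le (isSelfAdjoint_sqrt_mul_mul_sqrt hA)]
  have hr : IsSelfAdjoint (CFC.sqrt B) := .of_nonneg (CFC.sqrt_nonneg B)
  have hS (y : H) : inner ℂ ((CFC.sqrt B * A * CFC.sqrt B) y) y =
      inner ℂ (A (CFC.sqrt B y)) (CFC.sqrt B y) := hr.isSymmetric _ _
  have hRR (x : H) : CFC.sqrt B (CFC.sqrt B x) = B x := by
    change (CFC.sqrt B * CFC.sqrt B) x = _
    rw [CFC.sqrt_mul_sqrt_self B hB]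
  have hnorm (x : H) : (inner ℂ (B x) x).re = ‖CFC.sqrt B x‖ ^ 2 := by
    rw [← inner_sqrt_apply_sqrt_apply hB, inner_self_eq_norm_sq_to_K]
    norm_cast
  simp only [hS, hnorm]
  constructor
  · refine fun h => ⟨fun x => ?_, fun x => ?_⟩
    · simpa only [hRR] using h (CFC.sqrt B x)
    · refine le_trans ?_ (h x)
      have h1 : ‖inner ℂ (A (CFC.sqrt B x)) (CFC.sqrt B x)‖ ≤ C * ‖CFC.sqrt B x‖ ^ 2 := by
        refine (norm_inner_le_norm _ _).trans ?_
        rw [pow_two, ← mul_assoc]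
        gcongr
        exact A.le_of_opNorm_le hC _
      exact (abs_le.1 ((Complex.abs_re_le_norm _).trans h1)).1
  · rintro ⟨h1, h2⟩ y
    obtain ⟨y₁, hy₁, y₀, hy₀, rfl⟩ :=
      (LinearMap.range (CFC.sqrt B).toLinearMap).topologicalClosure.exists_add_mem_mem_orthogonal y
    have hker : CFC.sqrt B y₀ = 0 := by
      rw [Submodule.orthogonal_closure] at hy₀
      refine (inner_self_eq_zero (𝕜 := ℂ)).1 ?_
      rw [show inner ℂ (CFC.sqrt B y₀) (CFC.sqrt B y₀) = inner ℂ (CFC.sqrt B (CFC.sqrt B y₀)) y₀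
        from (hr.isSymmetric _ _).symm]
      exact hy₀ _ ⟨CFC.sqrt B y₀, rfl⟩
    have hcl : IsClosed {y | (inner ℂ (A (CFC.sqrt B y)) (CFC.sqrt B y)).re ≤ M * ‖y‖ ^ 2} :=
      isClosed_le (by fun_prop) (by fun_prop)
    have hy : (inner ℂ (A (CFC.sqrt B y₁)) (CFC.sqrt B y₁)).re ≤ M * ‖y₁‖ ^ 2 := by
      refine closure_minimal ?_ hcl hy₁
      rintro _ ⟨x, rfl⟩
      simpa [hRR] using h1 x
    have hM : 0 ≤ M * ‖y₀‖ ^ 2 := by simpa [hker] using h2 y₀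
    have hpyth : ‖y₁ + y₀‖ ^ 2 = ‖y₁‖ ^ 2 + ‖y₀‖ ^ 2 := by
      simpa only [pow_two] using
        norm_add_sq_eq_norm_sq_add_norm_sq_of_inner_eq_zero y₁ y₀ (hy₀ y₁ hy₁)
    rw [map_add, hker, add_zero, hpyth, mul_add]
    linarith

theorem im_eq_zero_of_mem_spectrum_mul {A B : H →L[ℂ] H} (hA : IsSelfAdjoint A) (hB : 0 ≤ B)
    {z : ℂ} (hz : z ∈ spectrum ℂ (A * B)) : z.im = 0 := by
  rw [spectrum_mul_eq_sqrt A hB] at hz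
  exact (isSelfAdjoint_sqrt_mul_mul_sqrt hA).im_eq_zero_of_mem_spectrum hz

theorem isGreatest_isLeast_realSpectrum_mul [Nontrivial H] {A B : H →L[ℂ] H}
    (hA : IsSelfAdjoint A) (hB : 0 ≤ B) :
    IsGreatest (realSpectrum (A * B)) (sSup (realSpectrum (A * B))) ∧
      IsLeast (realSpectrum (A * B)) (sInf (realSpectrum (A * B))) := by
  have hc := isCompact_realSpectrum (A * B)
  have hne := realSpectrum_mul_nonempty hA hB
  exact ⟨hc.isGreatest_sSup hne, hc.isLeast_sInf hne⟩

theorem le_of_mem_realSpectrum_mul {A B : H →L[ℂ] H} {a b : ℝ} (hA : ‖A‖ ≤ a) (hB : ‖B‖ ≤ b)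
    {t : ℝ} (ht : t ∈ realSpectrum (A * B)) : t ≤ a * b := by
  rcases subsingleton_or_nontrivial H with hH | hH
  · exact absurd (show (t : ℂ) ∈ spectrum ℂ (A * B) from ht) (by simp)
  · have h1 : ‖(t : ℂ)‖ ≤ ‖A * B‖ := spectrum.norm_le_norm_of_mem ht
    rw [Complex.norm_real] at h1
    refine (Real.le_norm_self t).trans (h1.trans ((norm_mul_le A B).trans ?_))
    gcongr
    exact (norm_nonneg A).trans hA

end Hilbert

/-! ### Fourier modes and multiplication operators -/

/-- The Fourier mode `e^{ikx}` as an element of `L²(𝕋)`. -/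
def mode (k : ℤ) : L2 := fourierLp 2 k

/-- Multiplication by a complex continuous function, as a bounded operator on `L²(𝕋)`. -/
def mulC (f : C(Torus, ℂ)) : L2 →L[ℂ] L2 :=
  mulOp (ContinuousMap.toLp ∞ AddCircle.haarAddCircle ℂ f)

/-- A real continuous function on the torus, regarded as a complex valued one. -/
def toComplex (f : C(Torus, ℝ)) : C(Torus, ℂ) :=
  (⟨Complex.ofReal, Complex.continuous_ofReal⟩ : C(ℝ, ℂ)).comp f

theorem coe_fourierBasis_apply (k : ℤ) : fourierBasis (T := 2 * Real.pi) k = mode k := by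
  rw [coe_fourierBasis]; rfl

theorem inner_mode_eq_fourierCoeff (k : ℤ) (u : L2) :
    inner ℂ (mode k) u = fourierCoeff (u : Torus → ℂ) k := by
  rw [← fourierBasis_repr, HilbertBasis.repr_apply_apply, coe_fourierBasis_apply]

theorem mem_freqSpace_iff {S : Set ℤ} {u : L2} :
    u ∈ freqSpace S ↔ ∀ k ∉ S, inner ℂ (mode k) u = 0 := by
  simp only [inner_mode_eq_fourierCoeff]; rfl

theorem ext_inner_mode {u v : L2} (h : ∀ k, inner ℂ (mode k) u = inner ℂ (mode k) v) : u = v := by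
  apply (fourierBasis (T := 2 * Real.pi)).repr.injective
  ext k
  simpa only [HilbertBasis.repr_apply_apply, coe_fourierBasis_apply] using h k

theorem inner_mode_mode (j k : ℤ) : inner ℂ (mode j) (mode k) = if j = k then 1 else 0 :=
  orthonormal_iff_ite.1 orthonormal_fourier j k

theorem norm_mode (k : ℤ) : ‖mode k‖ = 1 := orthonormal_fourier.1 k

theorem mode_mem_freqSpace {S : Set ℤ} {k : ℤ} (hk : k ∈ S) : mode k ∈ freqSpace S := by
  rw [mem_freqSpace_iff]
  intro j hj
  rw [inner_mode_mode, if_neg (by rintro rfl; exact hj hk)]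

open Classical in
theorem inner_mode_starProjection (S : Set ℤ) (k : ℤ) (u : L2) :
    inner ℂ (mode k) ((freqSpace S).starProjection u) =
      if k ∈ S then inner ℂ (mode k) u else 0 := by
  split_ifs with hk
  · rw [← Submodule.inner_starProjection_left_eq_right,
      Submodule.starProjection_eq_self_iff.2 (mode_mem_freqSpace hk)]
  · exact mem_freqSpace_iff.1 (Submodule.starProjection_apply_mem _ _) k hk

theorem coeFn_mulC (f : C(Torus, ℂ)) (u : L2) :
    (mulC f u : Torus → ℂ) =ᵐ[AddCircle.haarAddCircle] fun x => f x * u x := by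
  filter_upwards [(ContinuousLinearMap.mul ℂ ℂ).coeFn_holder (r := 2)
    (ContinuousMap.toLp ∞ AddCircle.haarAddCircle ℂ f) u,
    ContinuousMap.coeFn_toLp (p := ∞) (𝕜 := ℂ) AddCircle.haarAddCircle f] with x h1 h2
  refine h1.trans ?_
  rw [h2]; rfl

theorem coeFn_mode (k : ℤ) :
    (mode k : Torus → ℂ) =ᵐ[AddCircle.haarAddCircle] fun x => fourier k x :=
  coeFn_fourierLp 2 k

theorem mulC_mulC (f g : C(Torus, ℂ)) (u : L2) : mulC f (mulC g u) = mulC (f * g) u := by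
  apply Lp.ext
  filter_upwards [coeFn_mulC f (mulC g u), coeFn_mulC g u, coeFn_mulC (f * g) u] with x h1 h2 h3
  rw [h1, h2, h3, ContinuousMap.mul_apply, mul_assoc]

theorem mulC_fourier_mode (b k : ℤ) : mulC (fourier b) (mode k) = mode (k + b) := by
  apply Lp.ext
  filter_upwards [coeFn_mulC (fourier b) (mode k), coeFn_mode k, coeFn_mode (k + b)] with x h1 h2 h3
  rw [h1, h2, h3, fourier_add, mul_comm]

theorem norm_mulC_apply_le_of_ae {f : C(Torus, ℂ)} {u : L2} {c : ℝ}
    (h : ∀ᵐ x ∂(AddCircle.haarAddCircle : Measure Torus), ‖f x * u x‖ ≤ c * ‖u x‖) :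
    ‖mulC f u‖ ≤ c * ‖u‖ := by
  apply Lp.norm_le_mul_norm_of_ae_le_mul
  filter_upwards [coeFn_mulC f u, h] with x h1 h2
  rwa [h1]

theorem norm_mulC_apply_le (f : C(Torus, ℂ)) (u : L2) : ‖mulC f u‖ ≤ ‖f‖ * ‖u‖ := by
  refine norm_mulC_apply_le_of_ae (.of_forall fun x => ?_)
  rw [norm_mul]
  gcongr
  exact f.norm_coe_le_norm x

theorem mulC_one (u : L2) : mulC 1 u = u := by
  apply Lp.ext
  filter_upwards [coeFn_mulC 1 u] with x h1
  rw [h1, ContinuousMap.one_apply, one_mul]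

theorem mulC_sub (f g : C(Torus, ℂ)) (u : L2) : mulC (f - g) u = mulC f u - mulC g u := by
  simp [mulC, mulOp]

theorem mulC_smul (c : ℂ) (f : C(Torus, ℂ)) (u : L2) : mulC (c • f) u = c • mulC f u := by
  simp [mulC, mulOp]

theorem inner_mulC_left (f : C(Torus, ℂ)) (u v : L2) :
    inner ℂ (mulC f u) v = inner ℂ u (mulC (star f) v) := by
  rw [L2.inner_def, L2.inner_def]
  apply integral_congr_ae
  filter_upwards [coeFn_mulC f u, coeFn_mulC (star f) v] with x h1 h2
  rw [h1, h2]
  simp [mul_comm, mul_left_comm]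

theorem star_toComplex (f : C(Torus, ℝ)) : star (toComplex f) = toComplex f := by
  ext x; simp [toComplex]

theorem norm_toComplex (f : C(Torus, ℝ)) : ‖toComplex f‖ = ‖f‖ := by
  simp [ContinuousMap.norm_eq_iSup_norm, toComplex]

theorem inner_mulC_toComplex_left (f : C(Torus, ℝ)) (u v : L2) :
    inner ℂ (mulC (toComplex f) u) v = inner ℂ u (mulC (toComplex f) v) := by
  rw [inner_mulC_left, star_toComplex]

theorem re_inner_mulC_nonneg {f : C(Torus, ℝ)} (hf : ∀ x, 0 ≤ f x) (u : L2) :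
    0 ≤ (inner ℂ (mulC (toComplex f) u) u).re := by
  -- `f` is the square of the continuous function `√f`
  let s : C(Torus, ℝ) := ⟨fun x => √(f x), by fun_prop⟩
  have hs : toComplex f = toComplex s * toComplex s := by
    ext x
    simp only [toComplex, ContinuousMap.comp_apply, ContinuousMap.mul_apply, s,
      ContinuousMap.coe_mk]
    rw [← Complex.ofReal_mul, Real.mul_self_sqrt (hf x)]
  rw [hs, ← mulC_mulC, inner_mulC_toComplex_left]
  exact inner_self_nonneg (𝕜 := ℂ)

theorem re_inner_mulC_le {f : C(Torus, ℝ)} {c : ℝ} (hf : ∀ x, f x ≤ c) (u : L2) :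
    (inner ℂ (mulC (toComplex f) u) u).re ≤ c * ‖u‖ ^ 2 := by
  have h := re_inner_mulC_nonneg (f := .const _ c - f) (fun x => by simp [hf x]) u
  have hc : toComplex (.const _ c - f) = (c : ℂ) • 1 - toComplex f := by
    ext x; simp [toComplex]
  rw [hc, mulC_sub, mulC_smul, mulC_one, inner_sub_left, inner_smul_left,
    inner_self_eq_norm_sq_to_K] at h
  simp [← Complex.ofReal_pow] at h
  exact h

/-! ### The antiunitary reflection of frequencies -/

/-- The map `u ↦ e^{inx} * conj u`, which exchanges the frequencies `k` and `n - k`. -/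
def reflect (n : ℤ) (u : L2) : L2 := mulC (fourier n) (star u)

theorem coeFn_reflect (n : ℤ) (u : L2) : (reflect n u : Torus → ℂ) =ᵐ[AddCircle.haarAddCircle]
    fun x => fourier n x * star (u x) := by
  filter_upwards [coeFn_mulC (fourier n) (star u), Lp.coeFn_star u] with x h1 h2
  rw [reflect, h1, h2, Pi.star_apply]

theorem inner_mode_reflect (n k : ℤ) (u : L2) :
    inner ℂ (mode k) (reflect n u) = star (inner ℂ (mode (n - k)) u) := by
  rw [L2.inner_def, L2.inner_def]
  refine Eq.trans ?_ integral_conj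
  apply integral_congr_ae
  filter_upwards [coeFn_mode k, coeFn_mode (n - k), coeFn_reflect n u] with x h1 h2 h3
  rw [h1, h2, h3, sub_eq_add_neg, fourier_add, fourier_neg]
  simp only [RCLike.inner_apply, map_mul, RCLike.star_def, Complex.conj_conj]
  ring

theorem reflect_mulC (n : ℤ) (f : C(Torus, ℝ)) (u : L2) :
    reflect n (mulC (toComplex f) u) = mulC (toComplex f) (reflect n u) := by
  apply Lp.ext
  filter_upwards [coeFn_reflect n (mulC (toComplex f) u), coeFn_mulC (toComplex f) u,
    coeFn_mulC (toComplex f) (reflect n u), coeFn_reflect n u] with x h1 h2 h3 h4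
  rw [h1, h2, h3, h4, star_mul]
  have : star (toComplex f x) = toComplex f x := by
    conv_rhs => rw [← star_toComplex]
    rfl
  rw [this]; ring

theorem norm_reflect_le (n : ℤ) (u : L2) : ‖reflect n u‖ ≤ ‖u‖ := by
  apply Lp.norm_le_norm_of_ae_le
  filter_upwards [coeFn_reflect n u] with x h
  rw [h, norm_mul, norm_star, fourier_apply, Circle.norm_coe, one_mul]

theorem reflect_smul (n : ℤ) (c : ℝ) (u : L2) :
    reflect n ((c : ℂ) • u) = (c : ℂ) • reflect n u := by
  apply ext_inner_mode
  intro k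
  rw [inner_mode_reflect, inner_smul_right, inner_smul_right, inner_mode_reflect, star_mul,
    mul_comm]
  simp

theorem reflect_starProjection (n : ℤ) (u : L2) :
    reflect n ((freqSpace (Set.Icc 0 n)).starProjection u) =
      (freqSpace (Set.Icc 0 n)).starProjection (reflect n u) := by
  apply ext_inner_mode
  intro k
  rw [inner_mode_reflect, inner_mode_starProjection, inner_mode_starProjection, inner_mode_reflect]
  have : n - k ∈ Set.Icc 0 n ↔ k ∈ Set.Icc 0 n := by
    simp only [Set.mem_Icc]; omega
  simp only [this]
  split_ifs <;> simp

/-! ### Compressions of multiplication operators -/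

theorem coe_cutOff_apply (K : Submodule ℂ L2) [K.HasOrthogonalProjection] (f : C(Torus, ℝ))
    (x : K) : (cutOff K (symbol f) x : L2) = K.starProjection (mulC (toComplex f) x) := rfl

theorem inner_cutOff_right (K : Submodule ℂ L2) [K.HasOrthogonalProjection] (f : C(Torus, ℝ))
    (x y : K) : inner ℂ x (cutOff K (symbol f) y) = inner ℂ (x : L2) (mulC (toComplex f) y) := by
  rw [Submodule.coe_inner, coe_cutOff_apply, ← Submodule.inner_starProjection_left_eq_right,
    Submodule.starProjection_eq_self_iff.2 x.2]

theorem inner_cutOff_left (K : Submodule ℂ L2) [K.HasOrthogonalProjection] (f : C(Torus, ℝ))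
    (x y : K) : inner ℂ (cutOff K (symbol f) x) y = inner ℂ (mulC (toComplex f) x) (y : L2) := by
  rw [Submodule.coe_inner, coe_cutOff_apply, Submodule.inner_starProjection_left_eq_right,
    Submodule.starProjection_eq_self_iff.2 y.2]

theorem isSelfAdjoint_cutOff (K : Submodule ℂ L2) [K.HasOrthogonalProjection] [CompleteSpace K]
    (f : C(Torus, ℝ)) : IsSelfAdjoint (cutOff K (symbol f)) := by
  rw [ContinuousLinearMap.isSelfAdjoint_iff_isSymmetric]
  intro x y
  exact (inner_cutOff_left K f x y).trans
    ((inner_mulC_toComplex_left f _ _).trans (inner_cutOff_right K f x y).symm)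

theorem cutOff_nonneg (K : Submodule ℂ L2) [K.HasOrthogonalProjection] [CompleteSpace K]
    {f : C(Torus, ℝ)} (hf : ∀ x, 0 ≤ f x) : 0 ≤ cutOff K (symbol f) := by
  rw [ContinuousLinearMap.nonneg_iff_isPositive, ContinuousLinearMap.isPositive_def]
  refine ⟨(isSelfAdjoint_cutOff K f).isSymmetric, fun x => ?_⟩
  rw [ContinuousLinearMap.reApplyInnerSelf_apply, inner_cutOff_left]
  exact re_inner_mulC_nonneg hf x

theorem norm_cutOff_le (K : Submodule ℂ L2) [K.HasOrthogonalProjection] (f : C(Torus, ℝ)) :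
    ‖cutOff K (symbol f)‖ ≤ ‖f‖ := by
  refine ContinuousLinearMap.opNorm_le_bound _ (norm_nonneg _) fun x => ?_
  change ‖K.starProjection (mulC (toComplex f) x)‖ ≤ ‖f‖ * ‖(x : L2)‖
  refine (K.norm_starProjection_apply_le _).trans ((norm_mulC_apply_le _ _).trans ?_)
  rw [norm_toComplex]

theorem cutOff_symbol_neg (K : Submodule ℂ L2) [K.HasOrthogonalProjection] (f : C(Torus, ℝ)) :
    cutOff K (symbol (-f)) = -cutOff K (symbol f) := by
  ext1 x
  apply Subtype.ext
  have : toComplex (-f) = (-1 : ℂ) • toComplex f := by ext x; simp [toComplex]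
  rw [coe_cutOff_apply, this, mulC_smul, map_smul, neg_one_smul]
  rfl

/-! ### Strong limits -/

/-- Uniformly bounded linear maps that tend to zero pointwise on a set with dense span tend to zero
pointwise. -/
theorem tendsto_zero_of_span_dense {ι E F : Type*} [NormedAddCommGroup E] [NormedSpace ℂ E]
    [NormedAddCommGroup F] [NormedSpace ℂ F] {l : Filter ι} {T : ι → E →ₗ[ℂ] F} {C : ℝ}
    (hC : ∀ i x, ‖T i x‖ ≤ C * ‖x‖) {s : Set E}
    (hs : (Submodule.span ℂ s).topologicalClosure = ⊤)
    (h : ∀ x ∈ s, Tendsto (fun i => T i x) l (𝓝 0)) (x : E) :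
    Tendsto (fun i => T i x) l (𝓝 0) := by
  have hspan : ∀ y ∈ Submodule.span ℂ s, Tendsto (fun i => T i y) l (𝓝 0) := by
    intro y hy
    induction hy using Submodule.span_induction with
    | mem y hy => exact h y hy
    | zero => simpa using tendsto_const_nhds
    | add y z _ _ hy hz => simpa using hy.add hz
    | smul c y _ hy => simpa using hy.const_smul c
  rw [Metric.tendsto_nhds]
  intro ε hε
  have hx : x ∈ (Submodule.span ℂ s).topologicalClosure := hs ▸ Submodule.mem_top
  have hC' : 0 < |C| + 1 := by positivity
  obtain ⟨y, hy, hxy⟩ := Metric.mem_closure_iff.1 hx (ε / 2 / (|C| + 1)) (by positivity)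
  filter_upwards [Metric.tendsto_nhds.1 (hspan y hy) (ε / 2) (half_pos hε)] with i hi
  rw [dist_zero_right] at hi ⊢
  rw [dist_eq_norm, lt_div_iff₀ hC'] at hxy
  calc ‖T i x‖ = ‖T i (x - y) + T i y‖ := by rw [← map_add, sub_add_cancel]
    _ ≤ C * ‖x - y‖ + ‖T i y‖ := (norm_add_le _ _).trans (by gcongr; exact hC i _)
    _ < ε := by nlinarith [norm_nonneg (x - y), le_abs_self C]

theorem span_mode_closure_eq_top :
    (Submodule.span ℂ (Set.range mode)).topologicalClosure = ⊤ :=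
  span_fourierLp_closure_eq_top (by simp)

/-- `Π_n → Π` strongly. -/
theorem tendsto_starProjection_imPiN (u : L2) :
    Tendsto (fun n : ℕ => (imPiN n).starProjection u) atTop (𝓝 (imPi.starProjection u)) := by
  rw [tendsto_iff_norm_sub_tendsto_zero, ← tendsto_zero_iff_norm_tendsto_zero]
  refine tendsto_zero_of_span_dense
    (T := fun n : ℕ => ((imPiN n).starProjection - imPi.starProjection : L2 →L[ℂ] L2).toLinearMap)
    (C := 2) ?_ span_mode_closure_eq_top ?_ u
  · intro n x
    change ‖(imPiN n).starProjection x - imPi.starProjection x‖ ≤ 2 * ‖x‖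
    refine (norm_sub_le _ _).trans ?_
    linarith [(imPiN n).norm_starProjection_apply_le x, imPi.norm_starProjection_apply_le x]
  · rintro _ ⟨k, rfl⟩
    refine tendsto_const_nhds.congr' ?_
    filter_upwards [eventually_ge_atTop k.toNat] with n hn
    symm
    refine sub_eq_zero.2 (ext_inner_mode fun j => ?_)
    change inner ℂ (mode j) ((freqSpace _).starProjection (mode k)) =
      inner ℂ (mode j) ((freqSpace _).starProjection (mode k))
    rw [inner_mode_starProjection, inner_mode_starProjection, inner_mode_mode]
    simp only [Set.mem_Icc, Set.mem_Ici]
    split_ifs <;> first | rfl | omega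

theorem tendsto_coe_orthogonalProjectionOnto (x : imPi) :
    Tendsto (fun n : ℕ => ((imPiN n).orthogonalProjectionOnto (x : L2) : L2)) atTop (𝓝 x) := by
  have h := tendsto_starProjection_imPiN (x : L2)
  rwa [Submodule.starProjection_eq_self_iff.2 x.2] at h

/-- `T_n(f) → T(f)` strongly. -/
theorem tendsto_toeplitzN_apply {f : C(Torus, ℝ)} {x : ∀ n, imPiN n} {y : imPi}
    (h : Tendsto (fun n => (x n : L2)) atTop (𝓝 y)) :
    Tendsto (fun n => (toeplitzN n (symbol f) (x n) : L2)) atTop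
      (𝓝 (toeplitz (symbol f) y : L2)) := by
  have h1 : Tendsto (fun n => mulC (toComplex f) (x n)) atTop (𝓝 (mulC (toComplex f) y)) :=
    ((mulC (toComplex f)).continuous.tendsto _).comp h
  have h2 := tendsto_starProjection_imPiN (mulC (toComplex f) y)
  have h3 : Tendsto (fun n : ℕ => (imPiN n).starProjection
      (mulC (toComplex f) (x n) - mulC (toComplex f) y)) atTop (𝓝 0) := by
    refine squeeze_zero_norm (fun n => (imPiN n).norm_starProjection_apply_le _) ?_
    exact (tendsto_iff_norm_sub_tendsto_zero.1 h1)
  have := h3.add h2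
  simp only [map_sub, sub_add_cancel, zero_add] at this
  exact this

/-! ### Approximate eigenvectors concentrated at a point -/

/-- Multiplication by `e^{imx}` for large `m` moves a function into the range of `Π`, up to a small
error. -/
theorem tendsto_starProjection_shift_sub (u : L2) :
    Tendsto (fun m : ℕ => imPi.starProjection (mulC (fourier (m : ℤ)) u) - mulC (fourier (m : ℤ)) u)
      atTop (𝓝 0) := by
  refine tendsto_zero_of_span_dense
    (T := fun m : ℕ => (imPi.starProjection ∘L mulC (fourier (m : ℤ)) - mulC (fourier (m : ℤ)) :
      L2 →L[ℂ] L2).toLinearMap)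
    (C := 2) ?_ span_mode_closure_eq_top ?_ u
  · intro m x
    have h1 := norm_mulC_apply_le (fourier (m : ℤ)) x
    rw [fourier_norm] at h1
    change ‖imPi.starProjection (mulC (fourier (m : ℤ)) x) - mulC (fourier (m : ℤ)) x‖ ≤ 2 * ‖x‖
    refine (norm_sub_le _ _).trans ?_
    have h2 := imPi.norm_starProjection_apply_le (mulC (fourier (m : ℤ)) x)
    linarith
  · rintro _ ⟨k, rfl⟩
    refine tendsto_const_nhds.congr' ?_
    filter_upwards [eventually_ge_atTop (-k).toNat] with m hm
    symm
    refine sub_eq_zero.2 ?_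
    change imPi.starProjection (mulC (fourier (m : ℤ)) (mode k)) = mulC (fourier (m : ℤ)) (mode k)
    rw [mulC_fourier_mode]
    exact Submodule.starProjection_eq_self_iff.2 (mode_mem_freqSpace (by simp; omega))

/-- There is a nonzero function `w` in `L²(𝕋)` living where `f` and `g` are close to their values at
`a`: the same is then true of its products `b w`. -/
theorem exists_concentrated (f g : C(Torus, ℝ)) (a : Torus) {ε : ℝ} (hε : 0 < ε) :
    ∃ w : L2, w ≠ 0 ∧ ∀ b : C(Torus, ℂ), ‖mulC (toComplex f) (mulC b w) - (f a : ℂ) • mulC b w‖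
        ≤ ε * ‖mulC b w‖ ∧
      ‖mulC (toComplex g) (mulC b w) - (g a : ℂ) • mulC b w‖ ≤ ε * ‖mulC b w‖ := by
  set U : Set Torus := {x | |f x - f a| < ε ∧ |g x - g a| < ε} with hU
  have hUo : IsOpen U :=
    (isOpen_lt (f := fun x => |f x - f a|) (by fun_prop) continuous_const).inter
      (isOpen_lt (f := fun x => |g x - g a|) (by fun_prop) continuous_const)
  have hpos : AddCircle.haarAddCircle U ≠ 0 :=
    (hUo.measure_pos _ ⟨a, by simp [hU, hε]⟩).ne'
  have hfin : AddCircle.haarAddCircle U ≠ ∞ := measure_ne_top _ _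
  set v : L2 := indicatorConstLp 2 hUo.measurableSet hfin (1 : ℂ) with hv
  have hv0 : v ≠ 0 := by
    rw [← norm_ne_zero_iff, hv, norm_indicatorConstLp (by simp) (by simp)]
    simp only [norm_one, one_mul]
    exact (Real.rpow_pos_of_pos (ENNReal.toReal_pos hpos hfin) _).ne'
  have hae : ∀ᵐ x ∂(AddCircle.haarAddCircle : Measure Torus), x ∉ U → v x = 0 :=
    indicatorConstLp_coeFn_notMem
  have main (h : C(Torus, ℝ)) (hh : ∀ x ∈ U, |h x - h a| < ε) (b : C(Torus, ℂ)) :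
      ‖mulC (toComplex h) (mulC b v) - (h a : ℂ) • mulC b v‖ ≤ ε * ‖mulC b v‖ := by
    have : mulC (toComplex h) (mulC b v) - (h a : ℂ) • mulC b v =
        mulC (toComplex h - (h a : ℂ) • 1) (mulC b v) := by
      rw [mulC_sub, mulC_smul, mulC_one]
    rw [this]
    apply norm_mulC_apply_le_of_ae
    filter_upwards [hae, coeFn_mulC b v] with x hx hb
    by_cases hxU : x ∈ U
    · rw [norm_mul]
      gcongr
      have : (toComplex h - (h a : ℂ) • 1) x = ((h x - h a : ℝ) : ℂ) := by simp [toComplex]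
      rw [this, Complex.norm_real]
      exact (hh x hxU).le
    · rw [hb, hx hxU]; simp
  exact ⟨v, hv0, fun b => ⟨main f (fun x hx => hx.1) b, main g (fun x hx => hx.2) b⟩⟩

theorem norm_mulC_fourier (m : ℤ) (u : L2) : ‖mulC (fourier m) u‖ = ‖u‖ := by
  rw [Lp.norm_def, Lp.norm_def]
  congr 1
  apply eLpNorm_congr_norm_ae
  filter_upwards [coeFn_mulC (fourier m) u] with x h
  rw [h, norm_mul, fourier_apply, Circle.norm_coe, one_mul]

/-- If `v` is an approximate eigenvector of multiplication by `f`, then an element `h` of `K` close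
to `v` is one of the compression. -/
theorem norm_cutOff_sub_smul_le {K : Submodule ℂ L2} [K.HasOrthogonalProjection] (f : C(Torus, ℝ))
    (a : Torus) (h : K) {v : L2} {ε : ℝ}
    (hv : ‖mulC (toComplex f) v - (f a : ℂ) • v‖ ≤ ε * ‖v‖) :
    ‖cutOff K (symbol f) h - (f a : ℂ) • h‖ ≤ 2 * ‖f‖ * ‖(h : L2) - v‖ + ε * ‖v‖ := by
  have h1 : ((cutOff K (symbol f) h - (f a : ℂ) • h : K) : L2) =
      K.starProjection (mulC (toComplex f) h - (f a : ℂ) • (h : L2)) := by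
    rw [map_sub, map_smul, Submodule.starProjection_eq_self_iff.2 h.2]; rfl
  change ‖((cutOff K (symbol f) h - (f a : ℂ) • h : K) : L2)‖ ≤ _
  rw [h1]
  have h2 : mulC (toComplex f) h - (f a : ℂ) • (h : L2) =
      (mulC (toComplex f) (h - v) - (f a : ℂ) • ((h : L2) - v)) +
        (mulC (toComplex f) v - (f a : ℂ) • v) := by
    rw [map_sub, smul_sub]; abel
  have h3 := norm_mulC_apply_le (toComplex f) (h - v)
  rw [norm_toComplex] at h3
  have h4 : ‖(f a : ℂ) • ((h : L2) - v)‖ ≤ ‖f‖ * ‖(h : L2) - v‖ := by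
    rw [norm_smul, Complex.norm_real]
    gcongr
    exact f.norm_coe_le_norm a
  refine (K.norm_starProjection_apply_le _).trans ?_
  rw [h2]
  refine (norm_add_le _ _).trans ?_
  have := norm_sub_le (mulC (toComplex f) (h - v)) ((f a : ℂ) • ((h : L2) - v))
  linarith

/-- The values of `f g` belong to the spectrum of `T(f) T(g)`: functions in the range of `Π` that
are concentrated near `a` are approximate eigenvectors for `f a * g a`. -/
theorem mul_apply_mem_realSpectrum (f g : C(Torus, ℝ)) (a : Torus) :
    f a * g a ∈ realSpectrum (toeplitz (symbol f) * toeplitz (symbol g)) := by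
  change ((f a * g a : ℝ) : ℂ) ∈ spectrum ℂ _
  rw [spectrum.mem_iff]
  rintro ⟨U, hU⟩
  set N : ℝ := ‖(↑U⁻¹ : imPi →L[ℂ] imPi)‖
  have hbelow (h : imPi) : ‖h‖ ≤ N * ‖(f a : ℂ) • (g a : ℂ) • h -
      toeplitz (symbol f) (toeplitz (symbol g) h)‖ := by
    have h1 : (↑U⁻¹ : imPi →L[ℂ] imPi) ((U : imPi →L[ℂ] imPi) h) = h := by
      change ((↑U⁻¹ : imPi →L[ℂ] imPi) * (U : imPi →L[ℂ] imPi)) h = h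
      rw [Units.inv_mul]; rfl
    have h2 : (U : imPi →L[ℂ] imPi) h = (f a : ℂ) • (g a : ℂ) • h -
        toeplitz (symbol f) (toeplitz (symbol g) h) := by
      rw [hU, Algebra.algebraMap_eq_smul_one, smul_smul]
      push_cast
      rfl
    calc ‖h‖ = ‖(↑U⁻¹ : imPi →L[ℂ] imPi) ((U : imPi →L[ℂ] imPi) h)‖ := by rw [h1]
      _ ≤ N * ‖(U : imPi →L[ℂ] imPi) h‖ := ContinuousLinearMap.le_opNorm _ _
      _ = _ := by rw [h2]
  have hN : 0 ≤ N := ContinuousLinearMap.opNorm_nonneg _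
  set D : ℝ := ‖f‖ * (2 * ‖g‖ + 1) + ‖g‖ * (2 * ‖f‖ + 1)
  have hD : 0 ≤ D := by positivity
  -- chosen so that `ε ≤ 1 / 4` and `N * (ε * D) ≤ 1 / 4`
  set ε : ℝ := 1 / (4 * (N * D + 1))
  have hε : 0 < ε := by positivity
  have hεN : ε * (N * D + 1) = 1 / 4 := by simp only [ε]; field_simp
  obtain ⟨w, hw0, hw⟩ := exists_concentrated f g a hε
  have hwpos : 0 < ‖w‖ := norm_pos_iff.2 hw0
  obtain ⟨m, hm⟩ := ((tendsto_zero_iff_norm_tendsto_zero.1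
    (tendsto_starProjection_shift_sub w)).eventually (gt_mem_nhds (mul_pos hε hwpos))).exists
  obtain ⟨hwf, hwg⟩ := hw (fourier (m : ℤ))
  set v : L2 := mulC (fourier (m : ℤ)) w
  have hv : ‖v‖ = ‖w‖ := norm_mulC_fourier _ _
  set h : imPi := imPi.orthogonalProjectionOnto v
  have hhv : ‖(h : L2) - v‖ < ε * ‖w‖ := hm
  have hf := norm_cutOff_sub_smul_le f a h hwf
  have hg := norm_cutOff_sub_smul_le g a h hwg
  rw [hv] at hf hg
  have hfn := norm_nonneg f
  have hgn := norm_nonneg g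
  have hf' : ‖toeplitz (symbol f) h - (f a : ℂ) • h‖ ≤ (2 * ‖f‖ + 1) * (ε * ‖w‖) := by
    refine hf.trans ?_
    nlinarith
  have hg' : ‖toeplitz (symbol g) h - (g a : ℂ) • h‖ ≤ (2 * ‖g‖ + 1) * (ε * ‖w‖) := by
    refine hg.trans ?_
    nlinarith
  have hsum : ‖(f a : ℂ) • (g a : ℂ) • h - toeplitz (symbol f) (toeplitz (symbol g) h)‖ ≤
      D * (ε * ‖w‖) := by
    have e1 : (f a : ℂ) • (g a : ℂ) • h - toeplitz (symbol f) (toeplitz (symbol g) h) =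
        -(toeplitz (symbol f) (toeplitz (symbol g) h - (g a : ℂ) • h) +
          (g a : ℂ) • (toeplitz (symbol f) h - (f a : ℂ) • h)) := by
      rw [map_sub, map_smul, smul_sub, smul_comm]; abel
    have e2 : ‖toeplitz (symbol f) (toeplitz (symbol g) h - (g a : ℂ) • h)‖ ≤
        ‖f‖ * ((2 * ‖g‖ + 1) * (ε * ‖w‖)) :=
      ((toeplitz (symbol f)).le_of_opNorm_le (norm_cutOff_le _ f) _).trans (by gcongr)
    have e3 : ‖(g a : ℂ) • (toeplitz (symbol f) h - (f a : ℂ) • h)‖ ≤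
        ‖g‖ * ((2 * ‖f‖ + 1) * (ε * ‖w‖)) := by
      rw [norm_smul, Complex.norm_real]
      gcongr
      exact g.norm_coe_le_norm a
    rw [e1, norm_neg]
    refine (norm_add_le _ _).trans ((add_le_add e2 e3).trans (le_of_eq ?_))
    simp only [D]; ring
  have hlow : ‖w‖ - ε * ‖w‖ < ‖h‖ := by
    have := norm_sub_norm_le v (h : L2)
    rw [norm_sub_rev, hv] at this
    change _ < ‖(h : L2)‖
    linarith
  have hup : ‖h‖ ≤ N * (D * (ε * ‖w‖)) := (hbelow h).trans (by gcongr)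
  nlinarith

/-! ### Eigenvectors of the finite sections -/

theorem finiteDimensional_freqSpace {S : Set ℤ} (hS : S.Finite) :
    FiniteDimensional ℂ (freqSpace S) := by
  have := hS.to_subtype
  let φ : freqSpace S →ₗ[ℂ] (S → ℂ) :=
    LinearMap.pi fun k => (innerSL ℂ (mode k)).toLinearMap ∘ₗ (freqSpace S).subtype
  refine FiniteDimensional.of_injective φ fun x y hxy => Subtype.ext (ext_inner_mode fun k => ?_)
  by_cases hk : k ∈ S
  · exact congrFun hxy ⟨k, hk⟩
  · rw [mem_freqSpace_iff.1 x.2 k hk, mem_freqSpace_iff.1 y.2 k hk]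

theorem exists_eigenvector {H : Type*} [NormedAddCommGroup H] [NormedSpace ℂ H]
    [FiniteDimensional ℂ H] {T : H →L[ℂ] H} {t : ℝ} (ht : t ∈ realSpectrum T) :
    ∃ u : H, ‖u‖ = 1 ∧ T u = (t : ℂ) • u := by
  have hT : Module.End.HasEigenvalue (T : H →ₗ[ℂ] H) (t : ℂ) := by
    rw [Module.End.hasEigenvalue_iff_mem_spectrum]
    have := AlgEquiv.spectrum_eq (Module.End.toContinuousLinearMap (𝕜 := ℂ) H) (T : H →ₗ[ℂ] H)
    rw [← this]
    exact ht
  obtain ⟨v, hv⟩ := hT.exists_hasEigenvector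
  have hv0 : ‖v‖ ≠ 0 := norm_ne_zero_iff.2 hv.2
  have hTv : T v = (t : ℂ) • v := hv.apply_eq_smul
  refine ⟨((‖v‖⁻¹ : ℝ) : ℂ) • v, ?_, ?_⟩
  · rw [norm_smul, Complex.norm_real, norm_inv, norm_norm, inv_mul_cancel₀ hv0]
  · rw [map_smul, hTv, smul_comm]

/-- If the eigenvalues converge to a point outside the spectrum of `T(f) T(g)`, the eigenvectors
tend weakly to zero. -/
theorem tendsto_inner_eigenvector {f g : C(Torus, ℝ)} {l : Filter ℕ} (hl : l ≤ atTop)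
    {t : ℕ → ℝ} {s : ℝ} (ht : Tendsto t l (𝓝 s))
    (hs : s ∉ realSpectrum (toeplitz (symbol f) * toeplitz (symbol g)))
    {v : ∀ n, imPiN n} (hv1 : ∀ n, ‖v n‖ ≤ 1)
    (hv : ∀ n, (toeplitzN n (symbol f) * toeplitzN n (symbol g)) (v n) = (t n : ℂ) • v n)
    (w : imPi) : Tendsto (fun n => inner ℂ (w : L2) (v n)) l (𝓝 0) := by
  -- the adjoint of `s - T(f) T(g)` is `s - T(g) T(f)`, which is therefore onto
  have hunit : IsUnit (algebraMap ℂ (imPi →L[ℂ] imPi) s -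
      toeplitz (symbol g) * toeplitz (symbol f)) :=
    isUnit_sub_mul_of_notMem_realSpectrum (H := imPi) (isSelfAdjoint_cutOff imPi f)
      (isSelfAdjoint_cutOff imPi g) hs
  obtain ⟨U, hU⟩ := hunit
  set x : imPi := (↑U⁻¹ : imPi →L[ℂ] imPi) w
  have hx : (s : ℂ) • x - toeplitz (symbol g) (toeplitz (symbol f) x) = w := by
    have h1 : (U : imPi →L[ℂ] imPi) x = w := by
      change ((U : imPi →L[ℂ] imPi) * (↑U⁻¹ : imPi →L[ℂ] imPi)) w = w
      rw [Units.mul_inv]; rfl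
    rw [hU, Algebra.algebraMap_eq_smul_one] at h1
    exact h1
  set xn : ∀ n : ℕ, imPiN n := fun n => (imPiN n).orthogonalProjectionOnto (x : L2)
  have hxn : Tendsto (fun n => (xn n : L2)) atTop (𝓝 x) := tendsto_coe_orthogonalProjectionOnto x
  have hyn := tendsto_toeplitzN_apply (f := g) (tendsto_toeplitzN_apply (f := f) hxn)
  have hwn : Tendsto (fun n => (t n : ℂ) • (xn n : L2) -
      (toeplitzN n (symbol g) (toeplitzN n (symbol f) (xn n)) : L2)) l (𝓝 w) := by
    rw [← hx]
    exact ((Complex.continuous_ofReal.tendsto s).comp ht |>.smul (hxn.mono_left hl)).sub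
      (hyn.mono_left hl)
  have horth (n : ℕ) : inner ℂ ((t n : ℂ) • (xn n : L2) -
      (toeplitzN n (symbol g) (toeplitzN n (symbol f) (xn n)) : L2)) (v n : L2) = 0 := by
    have e1 : inner ℂ (toeplitzN n (symbol g) (toeplitzN n (symbol f) (xn n)) : L2) (v n : L2) =
        inner ℂ (xn n : L2) ((t n : ℂ) • (v n : L2)) := by
      refine (((isSelfAdjoint_cutOff (imPiN n) g).isSymmetric _ _).trans
        ((isSelfAdjoint_cutOff (imPiN n) f).isSymmetric _ _)).trans ?_
      exact congrArg (fun y : imPiN n => inner ℂ (xn n : L2) (y : L2)) (hv n)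
    rw [inner_sub_left, e1, inner_smul_left, inner_smul_right, Complex.conj_ofReal, sub_self]
  have hdiff : Tendsto (fun n => (w : L2) - ((t n : ℂ) • (xn n : L2) -
      (toeplitzN n (symbol g) (toeplitzN n (symbol f) (xn n)) : L2))) l (𝓝 0) := by
    simpa using hwn.const_sub (w : L2)
  refine squeeze_zero_norm (fun n => ?_) (tendsto_zero_iff_norm_tendsto_zero.1 hdiff)
  have := norm_inner_le_norm (𝕜 := ℂ) ((w : L2) - ((t n : ℂ) • (xn n : L2) -
      (toeplitzN n (symbol g) (toeplitzN n (symbol f) (xn n)) : L2))) (v n : L2)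
  rw [inner_sub_left, horth, sub_zero] at this
  exact this.trans (mul_le_of_le_one_right (norm_nonneg _) (hv1 n))

theorem reflect_mem_imPiN {n : ℕ} {u : L2} (hu : u ∈ imPiN n) : reflect n u ∈ imPiN n := by
  rw [← Submodule.starProjection_eq_self_iff (K := imPiN n)] at hu ⊢
  rw [← reflect_starProjection, hu]

/-- Finite sections of Toeplitz operators with real symbols commute with the reflection, so that it
maps eigenvectors of their products to eigenvectors. -/
theorem reflect_eigenvector {f g : C(Torus, ℝ)} {n : ℕ} {t : ℝ} {u : imPiN n}
    (hu : (toeplitzN n (symbol f) * toeplitzN n (symbol g)) u = (t : ℂ) • u) :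
    (toeplitzN n (symbol f) * toeplitzN n (symbol g)) ⟨reflect n u, reflect_mem_imPiN u.2⟩ =
      (t : ℂ) • ⟨reflect n u, reflect_mem_imPiN u.2⟩ := by
  have h1 := congrArg (fun x : imPiN n => reflect n (x : L2)) hu
  apply Subtype.ext
  change reflect n ((freqSpace (Set.Icc 0 (n : ℤ))).starProjection (mulC (toComplex f)
    ((freqSpace (Set.Icc 0 (n : ℤ))).starProjection (mulC (toComplex g) u)))) =
      reflect n ((t : ℂ) • (u : L2)) at h1
  rw [reflect_starProjection, reflect_mulC, reflect_starProjection, reflect_mulC, reflect_smul]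
    at h1
  exact h1

/-! ### Compactness of the corners -/

theorem inner_mode_mulC_fourier (b m : ℤ) (u : L2) :
    inner ℂ (mode m) (mulC (fourier b) u) = inner ℂ (mode (m - b)) u := by
  have h : (fourier b : C(Torus, ℂ)) = star (fourier (-b)) := by
    ext x
    rw [ContinuousMap.star_apply, fourier_neg, RCLike.star_def, Complex.conj_conj]
  rw [h, ← inner_mulC_left, mulC_fourier_mode, sub_eq_add_neg]

/-- The part of `e^{ibx} u` outside the frequencies `0, …, n`, for `u` with frequencies in this
range and `b ≥ 0`, comes from the last `b` coefficients of `u`. -/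
theorem mulC_fourier_sub_starProjection {n : ℕ} {u : L2} (hu : u ∈ imPiN n) (b : ℕ) :
    mulC (fourier (b : ℤ)) u - (imPiN n).starProjection (mulC (fourier (b : ℤ)) u) =
      ∑ j ∈ Finset.range b, inner ℂ (mode (n - j)) u • mode (n - j + b) := by
  refine ext_inner_mode fun m => ?_
  simp only [inner_sub_right, inner_mode_starProjection, inner_mode_mulC_fourier, inner_sum,
    inner_smul_right, inner_mode_mode, Set.mem_Icc]
  by_cases h1 : 0 ≤ m ∧ m ≤ n
  · rw [if_pos h1, sub_self, Finset.sum_eq_zero]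
    intro j hj
    rw [Finset.mem_range] at hj
    rw [if_neg (by omega), mul_zero]
  rw [if_neg h1, sub_zero]
  by_cases h2 : n < m ∧ m ≤ n + b
  · rw [Finset.sum_eq_single (n + b - m).toNat]
    · rw [if_pos (by omega), mul_one]
      congr 2
      omega
    · intro j _ hj
      rw [if_neg (by omega), mul_zero]
    · intro hj
      rw [Finset.mem_range] at hj
      omega
  · rw [mem_freqSpace_iff.1 hu (m - b) (by rw [Set.mem_Icc]; omega), Finset.sum_eq_zero]
    intro j hj
    rw [Finset.mem_range] at hj
    by_cases h3 : m = n - j + b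
    · omega
    · rw [if_neg h3, mul_zero]

/-- The part of `e^{-ibx} u` outside the frequencies `0, …, n`, for `u` with frequencies in this
range and `b ≥ 0`, comes from the first `b` coefficients of `u`. -/
theorem mulC_fourier_neg_sub_starProjection {n : ℕ} {u : L2} (hu : u ∈ imPiN n) (b : ℕ) :
    mulC (fourier (-b : ℤ)) u - (imPiN n).starProjection (mulC (fourier (-b : ℤ)) u) =
      ∑ j ∈ Finset.range b, inner ℂ (mode j) u • mode (j - b) := by
  refine ext_inner_mode fun m => ?_
  simp only [inner_sub_right, inner_mode_starProjection, inner_mode_mulC_fourier, inner_sum,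
    inner_smul_right, inner_mode_mode, Set.mem_Icc]
  by_cases h1 : 0 ≤ m ∧ m ≤ n
  · rw [if_pos h1, sub_self, Finset.sum_eq_zero]
    intro j hj
    rw [Finset.mem_range] at hj
    rw [if_neg (by omega), mul_zero]
  rw [if_neg h1, sub_zero]
  by_cases h2 : -b ≤ m ∧ m < 0
  · rw [Finset.sum_eq_single (m + b).toNat]
    · rw [if_pos (by omega), mul_one]
      congr 2
      omega
    · intro j _ hj
      rw [if_neg (by omega), mul_zero]
    · intro hj
      rw [Finset.mem_range] at hj
      omega
  · rw [mem_freqSpace_iff.1 hu (m - -b) (by rw [Set.mem_Icc]; omega), Finset.sum_eq_zero]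
    intro j hj
    rw [Finset.mem_range] at hj
    by_cases h3 : m = j - b
    · omega
    · rw [if_neg h3, mul_zero]

/-- If the first and the last coefficients of `u n` tend to zero, then multiplication by a
continuous function moves `u n` out of the range of `Π_n` only by a small amount. -/
theorem tendsto_mulC_sub_starProjection {l : Filter ℕ} {u : ∀ n, imPiN n} (hu : ∀ n, ‖u n‖ ≤ 1)
    (h0 : ∀ j : ℕ, Tendsto (fun n => inner ℂ (mode j) (u n : L2)) l (𝓝 0))
    (h1 : ∀ j : ℕ, Tendsto (fun n : ℕ => inner ℂ (mode (n - j)) (u n : L2)) l (𝓝 0))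
    (g : C(Torus, ℂ)) :
    Tendsto (fun n => mulC g (u n) - (imPiN n).starProjection (mulC g (u n))) l (𝓝 0) := by
  let T : ∀ n : ℕ, C(Torus, ℂ) →ₗ[ℂ] L2 := fun n =>
    { toFun := fun g => mulC g (u n) - (imPiN n).starProjection (mulC g (u n))
      map_add' := fun g₁ g₂ => by
        have : mulC (g₁ + g₂) (u n : L2) = mulC g₁ (u n) + mulC g₂ (u n) := by simp [mulC, mulOp]
        rw [this, map_add]; abel
      map_smul' := fun c g => by
        rw [mulC_smul, map_smul, ← smul_sub]; rfl }
  refine tendsto_zero_of_span_dense (T := T) (C := 2) ?_ span_fourier_closure_eq_top ?_ g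
  · intro n g
    change ‖mulC g (u n) - (imPiN n).starProjection (mulC g (u n))‖ ≤ 2 * ‖g‖
    have e1 := (imPiN n).norm_starProjection_apply_le (mulC g (u n))
    have e2 : ‖mulC g (u n)‖ ≤ ‖g‖ :=
      (norm_mulC_apply_le g (u n)).trans (mul_le_of_le_one_right (norm_nonneg _) (hu n))
    refine (norm_sub_le _ _).trans ?_
    linarith
  · rintro _ ⟨b, rfl⟩
    have key (c : ℕ → ℕ → ℂ) (e : ℕ → ℕ → ℤ) (b : ℕ)
        (hc : ∀ j, Tendsto (fun n => c n j) l (𝓝 0)) :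
        Tendsto (fun n => ∑ j ∈ Finset.range b, c n j • mode (e n j)) l (𝓝 0) := by
      rw [← Finset.sum_const_zero (s := Finset.range b)]
      refine tendsto_finsetSum _ fun j _ => ?_
      rw [tendsto_zero_iff_norm_tendsto_zero]
      simpa only [norm_smul, norm_mode, mul_one, norm_zero] using (hc j).norm
    obtain ⟨b, rfl | rfl⟩ := b.eq_nat_or_neg
    · refine Tendsto.congr (fun n => (mulC_fourier_sub_starProjection (u n).2 b).symm) ?_
      exact key _ _ b h1
    · refine Tendsto.congr (fun n => (mulC_fourier_neg_sub_starProjection (u n).2 b).symm) ?_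
      exact key _ _ b h0

/-! ### Limits of the extreme eigenvalues -/

/-- A limit of eigenvalues of `T_n(f) T_n(g)` outside the spectrum of `T(f) T(g)` is at most
`max (f g)`. -/
theorem le_of_tendsto_eigenvalue {f g : C(Torus, ℝ)} {l : Filter ℕ} [l.NeBot] (hl : l ≤ atTop)
    {t : ℕ → ℝ} {s : ℝ} (ht : Tendsto t l (𝓝 s))
    (htn : ∀ n, t n ∈ realSpectrum (toeplitzN n (symbol f) * toeplitzN n (symbol g)))
    (hs : s ∉ realSpectrum (toeplitz (symbol f) * toeplitz (symbol g)))
    {c : ℝ} (hc : ∀ x, f x * g x ≤ c) : s ≤ c := by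
  have (n : ℕ) : FiniteDimensional ℂ (imPiN n) :=
    finiteDimensional_freqSpace (Set.finite_Icc 0 (n : ℤ))
  choose u hu1 hu using fun n => exists_eigenvector (htn n)
  have h0 (j : ℕ) : Tendsto (fun n => inner ℂ (mode j) (u n : L2)) l (𝓝 0) :=
    tendsto_inner_eigenvector hl ht hs (fun n => (hu1 n).le) hu
      ⟨mode j, mode_mem_freqSpace (by simp)⟩
  have h1 (j : ℕ) : Tendsto (fun n : ℕ => inner ℂ (mode (n - j)) (u n : L2)) l (𝓝 0) := by
    have h2 : Tendsto (fun n : ℕ => inner ℂ (mode j) (reflect n (u n))) l (𝓝 0) :=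
      tendsto_inner_eigenvector (v := fun n => ⟨reflect n (u n), reflect_mem_imPiN (u n).2⟩) hl ht
        hs (fun n => (norm_reflect_le n (u n)).trans (hu1 n).le)
        (fun n => reflect_eigenvector (hu n)) ⟨mode j, mode_mem_freqSpace (by simp)⟩
    simpa only [inner_mode_reflect, star_star, star_zero] using h2.star
  have hcorner := tendsto_mulC_sub_starProjection (fun n => (hu1 n).le) h0 h1 (toComplex g)
  set r : ℕ → L2 := fun n =>
    mulC (toComplex g) (u n) - (imPiN n).starProjection (mulC (toComplex g) (u n))
  have hbound (n : ℕ) : t n ≤ c + ‖f‖ * ‖r n‖ := by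
    have hun : ‖(u n : L2)‖ = 1 := hu1 n
    have e1 : ((t n : ℝ) : ℂ) = inner ℂ (mulC (toComplex f) (u n))
        ((imPiN n).starProjection (mulC (toComplex g) (u n))) := by
      have e2 : inner ℂ (u n : L2) ((t n : ℂ) • (u n : L2)) = inner ℂ (mulC (toComplex f) (u n))
          ((imPiN n).starProjection (mulC (toComplex g) (u n))) := by
        rw [inner_mulC_toComplex_left]
        refine Eq.trans ?_ (inner_cutOff_right (imPiN n) f (u n)
          (toeplitzN n (symbol g) (u n)))
        exact (congrArg (fun y : imPiN n => inner ℂ (u n : L2) (y : L2)) (hu n)).symm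
      rw [← e2, inner_smul_right, inner_self_eq_norm_sq_to_K, hun]
      simp
    have e3 : (imPiN n).starProjection (mulC (toComplex g) (u n)) =
        mulC (toComplex g) (u n) - r n := by simp [r]
    have e4 : toComplex g * toComplex f = toComplex (f * g) := by
      ext x; simp [toComplex, mul_comm]
    have e5 := re_inner_mulC_le (f := f * g) hc (u n)
    rw [e3, inner_sub_right, ← inner_mulC_toComplex_left, mulC_mulC, e4] at e1
    have e6 := congrArg Complex.re e1
    rw [Complex.ofReal_re, Complex.sub_re] at e6
    have e7 : ‖inner ℂ (mulC (toComplex f) (u n)) (r n)‖ ≤ ‖f‖ * ‖r n‖ := by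
      refine (norm_inner_le_norm _ _).trans ?_
      gcongr
      refine (norm_mulC_apply_le _ _).trans ?_
      rw [norm_toComplex, hun, mul_one]
    have e8 := (abs_le.1 ((Complex.abs_re_le_norm _).trans e7)).1
    rw [hun] at e5
    linarith
  have hlim : Tendsto (fun n => c + ‖f‖ * ‖r n‖) l (𝓝 (c + ‖f‖ * 0)) :=
    tendsto_const_nhds.add ((tendsto_zero_iff_norm_tendsto_zero.1 hcorner).const_mul _)
  simpa using le_of_tendsto_of_tendsto' ht hlim hbound

theorem nontrivial_freqSpace {S : Set ℤ} {k : ℤ} (hk : k ∈ S) : Nontrivial (freqSpace S) :=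
  nontrivial_of_ne ⟨mode k, mode_mem_freqSpace hk⟩ 0 fun h => by
    have h1 : ‖mode k‖ = 0 := by rw [show mode k = 0 from congrArg Subtype.val h, norm_zero]
    rw [norm_mode] at h1
    exact one_ne_zero h1

instance instNontrivialImPi : Nontrivial imPi := nontrivial_freqSpace (k := 0) (by simp)

instance instNontrivialImPiN (n : ℕ) : Nontrivial (imPiN n) :=
  nontrivial_freqSpace (k := 0) (by simp)

theorem spectrum_cutOff_mul (K : Submodule ℂ L2) [K.HasOrthogonalProjection] [CompleteSpace K]
    [Nontrivial K] (f : C(Torus, ℝ)) {g : C(Torus, ℝ)} (hg : ∀ x, 0 ≤ g x) :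
    (∀ z ∈ spectrum ℂ (cutOff K (symbol f) * cutOff K (symbol g)), z.im = 0) ∧
      IsGreatest (realSpectrum (cutOff K (symbol f) * cutOff K (symbol g)))
        (sSup (realSpectrum (cutOff K (symbol f) * cutOff K (symbol g)))) ∧
      IsLeast (realSpectrum (cutOff K (symbol f) * cutOff K (symbol g)))
        (sInf (realSpectrum (cutOff K (symbol f) * cutOff K (symbol g)))) :=
  ⟨fun _ hz => im_eq_zero_of_mem_spectrum_mul (H := K) (isSelfAdjoint_cutOff K f)
    (cutOff_nonneg K hg) hz, isGreatest_isLeast_realSpectrum_mul (H := K)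
    (isSelfAdjoint_cutOff K f) (cutOff_nonneg K hg)⟩

theorem isGreatest_lambdaMax {f g : C(Torus, ℝ)} (hg : ∀ x, 0 ≤ g x) :
    IsGreatest (realSpectrum (toeplitz (symbol f) * toeplitz (symbol g))) (lambdaMax f g) :=
  (spectrum_cutOff_mul imPi f hg).2.1

theorem isGreatest_lambdaMaxN (n : ℕ) {f g : C(Torus, ℝ)} (hg : ∀ x, 0 ≤ g x) :
    IsGreatest (realSpectrum (toeplitzN n (symbol f) * toeplitzN n (symbol g)))
      (lambdaMaxN n f g) :=
  (spectrum_cutOff_mul (imPiN n) f hg).2.1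

theorem lambdaMinN_eq_neg (n : ℕ) (f g : C(Torus, ℝ)) :
    lambdaMinN n f g = -lambdaMaxN n (-f) g := by
  have h : toeplitzN n (symbol (-f)) = -toeplitzN n (symbol f) := cutOff_symbol_neg (imPiN n) f
  rw [lambdaMinN, lambdaMaxN, h, realSpectrum_neg_mul (H := imPiN n), Real.sInf_def]

theorem lambdaMin_eq_neg (f g : C(Torus, ℝ)) : lambdaMin f g = -lambdaMax (-f) g := by
  have h : toeplitz (symbol (-f)) = -toeplitz (symbol f) := cutOff_symbol_neg imPi f
  rw [lambdaMin, lambdaMax, h, realSpectrum_neg_mul (H := imPi), Real.sInf_def]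

/-- The quadratic form inequalities equivalent to an upper bound for the spectrum pass from the
finite sections to the limit. -/
theorem lambdaMax_le_of_frequently {f g : C(Torus, ℝ)} (hg : ∀ x, 0 ≤ g x) {M : ℝ}
    (h : ∃ᶠ n in atTop, lambdaMaxN n f g ≤ M) : lambdaMax f g ≤ M := by
  have hN : ∃ᶠ n in atTop, (∀ x : imPiN n, (inner ℂ (toeplitzN n (symbol f)
        (toeplitzN n (symbol g) x)) (toeplitzN n (symbol g) x)).re ≤
          M * (inner ℂ (toeplitzN n (symbol g) x) x).re) ∧
      ∀ x : imPiN n, -(‖f‖ * (inner ℂ (toeplitzN n (symbol g) x) x).re) ≤ M * ‖x‖ ^ 2 := by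
    refine h.mono fun n hn => ?_
    refine (realSpectrum_mul_le_iff (H := imPiN n) (isSelfAdjoint_cutOff (imPiN n) f)
      (cutOff_nonneg (imPiN n) hg) (norm_cutOff_le (imPiN n) f) M).1 fun t ht => ?_
    exact ((isGreatest_lambdaMaxN n hg).2 ht).trans hn
  refine (realSpectrum_mul_le_iff (H := imPi) (isSelfAdjoint_cutOff imPi f)
    (cutOff_nonneg imPi hg) (norm_cutOff_le imPi f) M).2 ?_ _ (isGreatest_lambdaMax hg).1
  set xn : imPi → ∀ n : ℕ, imPiN n := fun x n => (imPiN n).orthogonalProjectionOnto (x : L2)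
  have hx (x : imPi) : Tendsto (fun n => (xn x n : L2)) atTop (𝓝 x) :=
    tendsto_coe_orthogonalProjectionOnto x
  have hgx (x : imPi) := tendsto_toeplitzN_apply (f := g) (hx x)
  have hfgx (x : imPi) := tendsto_toeplitzN_apply (f := f) (hgx x)
  have hform (x : imPi) := (Complex.continuous_re.tendsto _).comp ((hgx x).inner (hx x) (𝕜 := ℂ))
  refine ⟨fun x => ?_, fun x => ?_⟩
  · exact le_of_tendsto_of_tendsto_of_frequently
      ((Complex.continuous_re.tendsto _).comp ((hfgx x).inner (hgx x) (𝕜 := ℂ)))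
      ((hform x).const_mul M) (hN.mono fun n hn => hn.1 (xn x n))
  · exact le_of_tendsto_of_tendsto_of_frequently ((hform x).const_mul ‖f‖).neg
      (((hx x).norm.pow 2).const_mul M) (hN.mono fun n hn => hn.2 (xn x n))

/-- A cluster point `s` of the `λ_max^n` lies in the spectrum of `T(f) T(g)` or is at most
`max (f g)`, which lies in that spectrum. -/
theorem le_lambdaMax_of_frequently {f g : C(Torus, ℝ)} (hg : ∀ x, 0 ≤ g x) {M : ℝ}
    (h : ∃ᶠ n in atTop, M ≤ lambdaMaxN n f g) : M ≤ lambdaMax f g := by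
  by_contra! hM
  have hne : NeBot (atTop ⊓ 𝓟 {n | M ≤ lambdaMaxN n f g}) := frequently_mem_iff_neBot.1 h
  set l : Ultrafilter ℕ := Ultrafilter.of (atTop ⊓ 𝓟 {n | M ≤ lambdaMaxN n f g})
  have hl := Ultrafilter.of_le (atTop ⊓ 𝓟 {n | M ≤ lambdaMaxN n f g})
  have hIcc : ∀ᶠ n in (l : Filter ℕ), lambdaMaxN n f g ∈ Set.Icc M (‖f‖ * ‖g‖) := by
    filter_upwards [le_principal_iff.1 (hl.trans inf_le_right)] with n hn
    exact ⟨hn, le_of_mem_realSpectrum_mul (H := imPiN n) (norm_cutOff_le (imPiN n) f)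
      (norm_cutOff_le (imPiN n) g) (isGreatest_lambdaMaxN n hg).1⟩
  obtain ⟨s, hs, hls⟩ := isCompact_Icc.ultrafilter_le_nhds
    (l.map fun n => lambdaMaxN n f g) (le_principal_iff.2 hIcc)
  obtain ⟨a, -, ha⟩ := isCompact_univ.exists_isMaxOn Set.univ_nonempty
    (f := fun x => f x * g x) (by fun_prop)
  have hsa : s ≤ f a * g a := le_of_tendsto_eigenvalue (hl.trans inf_le_left) hls
    (fun n => (isGreatest_lambdaMaxN n hg).1)
    (fun hmem => (hM.trans_le hs.1).not_ge ((isGreatest_lambdaMax hg).2 hmem))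
    (fun x => ha (Set.mem_univ x))
  exact (hM.trans_le (hs.1.trans hsa)).not_ge
    ((isGreatest_lambdaMax hg).2 (mul_apply_mem_realSpectrum f g a))

theorem tendsto_lambdaMaxN {f g : C(Torus, ℝ)} (hg : ∀ x, 0 ≤ g x) :
    Tendsto (fun n => lambdaMaxN n f g) atTop (𝓝 (lambdaMax f g)) := by
  refine tendsto_order.2 ⟨fun M hM => ?_, fun M hM => ?_⟩
  · by_contra h
    refine hM.not_ge (lambdaMax_le_of_frequently hg ?_)
    simpa only [not_eventually, not_lt] using h
  · by_contra h
    refine hM.not_ge (le_lambdaMax_of_frequently hg ?_)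
    simpa only [not_eventually, not_lt] using h

end ToeplitzProduct
end

/-- The first two blocks say that the spectra are real and that the extrema exist, so that the
numbers in the two limits are the maxima and minima of the spectra. -/
theorem theorem1 (f g : C(ToeplitzProduct.Torus, ℝ)) (hg : ∀ x, 0 ≤ g x) :
    (∀ n : ℕ,
      (∀ z ∈ spectrum ℂ (ToeplitzProduct.toeplitzN n (ToeplitzProduct.symbol f) *
        ToeplitzProduct.toeplitzN n (ToeplitzProduct.symbol g)), z.im = 0) ∧
      IsGreatest (ToeplitzProduct.realSpectrum
        (ToeplitzProduct.toeplitzN n (ToeplitzProduct.symbol f) *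
          ToeplitzProduct.toeplitzN n (ToeplitzProduct.symbol g)))
        (ToeplitzProduct.lambdaMaxN n f g) ∧
      IsLeast (ToeplitzProduct.realSpectrum
        (ToeplitzProduct.toeplitzN n (ToeplitzProduct.symbol f) *
          ToeplitzProduct.toeplitzN n (ToeplitzProduct.symbol g)))
        (ToeplitzProduct.lambdaMinN n f g)) ∧
    ((∀ z ∈ spectrum ℂ (ToeplitzProduct.toeplitz (ToeplitzProduct.symbol f) *
        ToeplitzProduct.toeplitz (ToeplitzProduct.symbol g)), z.im = 0) ∧
      IsGreatest (ToeplitzProduct.realSpectrum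
        (ToeplitzProduct.toeplitz (ToeplitzProduct.symbol f) *
          ToeplitzProduct.toeplitz (ToeplitzProduct.symbol g)))
        (ToeplitzProduct.lambdaMax f g) ∧
      IsLeast (ToeplitzProduct.realSpectrum
        (ToeplitzProduct.toeplitz (ToeplitzProduct.symbol f) *
          ToeplitzProduct.toeplitz (ToeplitzProduct.symbol g)))
        (ToeplitzProduct.lambdaMin f g)) ∧
    Tendsto (fun n : ℕ => ToeplitzProduct.lambdaMaxN n f g) atTop
      (𝓝 (ToeplitzProduct.lambdaMax f g)) ∧
    Tendsto (fun n : ℕ => ToeplitzProduct.lambdaMinN n f g) atTop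
      (𝓝 (ToeplitzProduct.lambdaMin f g)) := by
  refine ⟨fun n => ToeplitzProduct.spectrum_cutOff_mul (ToeplitzProduct.imPiN n) f hg,
    ToeplitzProduct.spectrum_cutOff_mul ToeplitzProduct.imPi f hg,
    ToeplitzProduct.tendsto_lambdaMaxN hg, ?_⟩
  -- the minima for `f` are the negatives of the maxima for `-f`
  simp only [ToeplitzProduct.lambdaMinN_eq_neg, ToeplitzProduct.lambdaMin_eq_neg]
  exact (ToeplitzProduct.tendsto_lambdaMaxN hg).neg
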